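/- Let $D\subset\mathbb R^d$ be compact, let $Z=\{Z(x),x\in D\}\sim \mathrm{GP}(0,G)$ be a centred real Gaussian process on a probability space $(\Omega,P)$ with continuous covariance kernel $G:D\times D\to\mathbb R$, let $C\subset D$ be compact and let $\nu$ be a probability measure on $C$. Let $(\lambda_n,\varphi_n)_n$ (a finite or infinite family) be the positive eigenvalues, counted with multiplicity, and corresponding $L^2(C,\nu)$-orthonormal eigenfunctions of the operator $T h(x)=\int_C G(x,y)h(y)\,d\nu(y)$ on $L^2(C,\nu)$. Let $$\xi_n=\frac1{\sqrt{\lambda_n}}\int_C Z(y)\varphi_n(y)\,d\nu(y)\quad\text{(mean-square integral)},\qquad \tilde\varphi_n(x)=\frac1{\lambda_n}\int_C G(x,y)\varphi_n(y)\,d\nu(y),\quad x\in D,$$ be the Karhunen–Loève coefficients of $Z$ on $C$ with respect to $\nu$ and the liftings of the eigenfunctions to $D$. Then the $\xi_n$ are independent $\mathcal N(0,1)$ random variables; for every $x\in D$ the series $\sum_n\sqrt{\lambda_n}\,\tilde\varphi_n(x)\,\xi_n$ converges (unconditionally) in $L^2(P)$; and for all $x,x'\in D$ the series $\sum_n\lambda_n\tilde\varphi_n(x)\tilde\varphi_n(x')$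 converges absolutely. Every version of the process $$Z_0(x)=Z(x)-\sum_n\sqrt{\lambda_n}\,\tilde\varphi_n(x)\,\xi_n,\qquad x\in D,$$ is a centred Gaussian process with covariance kernel $$G_0(x,x')=G(x,x')-\sum_n\lambda_n\,\tilde\varphi_n(x)\,\tilde\varphi_n(x'),\qquad x,x'\in D.$$ Moreover, for every $x\in\operatorname{supp}\nu$, $Z_0(x)=0$ almost surely and $G_0(x,x')=0$ for all $x'\in D$. In particular, if $\operatorname{supp}\nu=C$, then $Z_0(x)=0$ almost surely for every $x\in C$, and $G_0(\cdot,x')=0$ on $C$ for every $x'\in D$. -/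

import Mathlib

open MeasureTheory ProbabilityTheory Set

/-- `Z ∼ GP(0, G)` under `P`: a Gaussian process with zero mean and covariance kernel `G`. -/
structure IsCenteredGP {Ω T : Type*} [MeasurableSpace Ω] (Z : T → Ω → ℝ) (G : T → T → ℝ)
    (P : Measure Ω) : Prop where
  gaussian : IsGaussianProcess Z P
  mean_zero : ∀ x, ∫ ω, Z x ω ∂P = 0
  cov_eq : ∀ x x', cov[Z x, Z x'; P] = G x x'

theorem IsCenteredGP.memLp {Ω T : Type*} [MeasurableSpace Ω] {Z : T → Ω → ℝ} {G : T → T → ℝ}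
    {P : Measure Ω} (hZ : IsCenteredGP Z G P) (x : T) : MemLp (Z x) 2 P :=
  (hZ.gaussian.hasGaussianLaw_eval x).memLp_two

/-- The random variable `Z x` as an element of `L²(P)`. -/
noncomputable def IsCenteredGP.toL2 {Ω T : Type*} [MeasurableSpace Ω] {Z : T → Ω → ℝ}
    {G : T → T → ℝ} {P : Measure Ω} (hZ : IsCenteredGP Z G P) (x : T) : Lp ℝ 2 P :=
  (hZ.memLp x).toLp (Z x)

/-- `x ↦ ∫_C G(x, y) h(y) dν(y)`, as a function on the whole domain `T`. Its restriction to `C` is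
the Hilbert-Schmidt operator of `G` on `L²(C, ν)` applied to `h`. -/
noncomputable def kernelIntegral {T : Type*} [MeasurableSpace T] (G : T → T → ℝ) {C : Set T}
    (ν : Measure C) (h : Lp ℝ 2 ν) (x : T) : ℝ :=
  ∫ y : C, G x y * h y ∂ν

/-- `h` solves the eigenvalue equation `∫_C G(·, y) h(y) dν(y) = μ h` in `L²(C, ν)`. -/
def EigenEq {T : Type*} [MeasurableSpace T] (G : T → T → ℝ) {C : Set T}
    (ν : Measure C) (μ : ℝ) (h : Lp ℝ 2 ν) : Prop :=
  ∀ᵐ x : C ∂ν, kernelIntegral G ν h x = μ * h x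

/-- `(lam n, φ n)` are the positive eigenvalues, counted with multiplicity, and corresponding
orthonormal eigenfunctions of the Hilbert-Schmidt operator of `G` on `L²(C, ν)`. The index type
is arbitrary, since there may be finitely or infinitely many positive eigenvalues. -/
structure IsEigenSystem {T ι : Type*} [MeasurableSpace T] (G : T → T → ℝ) {C : Set T}
    (ν : Measure C) (lam : ι → ℝ) (φ : ι → Lp ℝ 2 ν) : Prop where
  pos : ∀ n, 0 < lam n
  orthonormal : Orthonormal ℝ φ
  eigen : ∀ n, EigenEq G ν (lam n) (φ n)
  exhaustive : ∀ (μ : ℝ) (h : Lp ℝ 2 ν), 0 < μ → EigenEq G ν μ h →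
    h ∈ (Submodule.span ℝ (range φ)).topologicalClosure

/-- The lifting `φ̃ₙ(x) = (1/λₙ) ∫_C G(x, y) φₙ(y) dν(y)` of the eigenfunctions to the whole
domain. -/
noncomputable def lifted {T ι : Type*} [MeasurableSpace T] (G : T → T → ℝ) {C : Set T}
    (ν : Measure C) (lam : ι → ℝ) (φ : ι → Lp ℝ 2 ν) (n : ι) (x : T) : ℝ :=
  1 / lam n * kernelIntegral G ν (φ n) x

/-- The Karhunen-Loève coefficients `ξₙ = λₙ^{-1/2} ∫_C Z(y) φₙ(y) dν(y)` (a mean-square integral,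
that is, the Bochner integral of an `L²(P)`-valued map). -/
noncomputable def klCoeff {Ω T ι : Type*} [MeasurableSpace Ω] [MeasurableSpace T]
    {Z : T → Ω → ℝ} {G : T → T → ℝ} {P : Measure Ω} (hZ : IsCenteredGP Z G P) {C : Set T}
    (ν : Measure C) (lam : ι → ℝ) (φ : ι → Lp ℝ 2 ν) (n : ι) : Lp ℝ 2 P :=
  (1 / √(lam n)) • ∫ y : C, φ n y • hZ.toL2 (y : T) ∂ν

/-- The terms `√λₙ φ̃ₙ(x) ξₙ` of the Karhunen-Loève series lifted to the whole domain. -/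
noncomputable def klTerm {Ω T ι : Type*} [MeasurableSpace Ω] [MeasurableSpace T]
    {Z : T → Ω → ℝ} {G : T → T → ℝ} {P : Measure Ω} (hZ : IsCenteredGP Z G P) {C : Set T}
    (ν : Measure C) (lam : ι → ℝ) (φ : ι → Lp ℝ 2 ν) (x : T) (n : ι) : Lp ℝ 2 P :=
  (√(lam n) * lifted G ν lam φ n x) • klCoeff hZ ν lam φ n

/-- `Z₀` is (a version of) the process `Z(x) - ∑ₙ √λₙ φ̃ₙ(x) ξₙ`, the series being taken in
`L²(P)`. -/
def IsKLResidual {Ω T ι : Type*} [MeasurableSpace Ω] [MeasurableSpace T]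
    {Z : T → Ω → ℝ} {G : T → T → ℝ} {P : Measure Ω} (hZ : IsCenteredGP Z G P) {C : Set T}
    (ν : Measure C) (lam : ι → ℝ) (φ : ι → Lp ℝ 2 ν) (Z₀ : T → Ω → ℝ) : Prop :=
  ∀ x, Z₀ x =ᵐ[P] fun ω => Z x ω - (∑' n, klTerm hZ ν lam φ x n : Lp ℝ 2 P) ω

/-- `G₀(x, x') = G(x, x') - ∑ₙ λₙ φ̃ₙ(x) φ̃ₙ(x')`. -/
noncomputable def residualKernel {T ι : Type*} [MeasurableSpace T] (G : T → T → ℝ) {C : Set T}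
    (ν : Measure C) (lam : ι → ℝ) (φ : ι → Lp ℝ 2 ν) (x x' : T) : ℝ :=
  G x x' - ∑' n, lam n * lifted G ν lam φ n x * lifted G ν lam φ n x'

/-! Everything takes place in L²(P). Let S : L²(C, ν) → L²(P), S h = ∫ h(y) Z(y) dν(y)
(`weightedIntegralCLM`). Since ⟪Z x, Z y⟫ = G x y, the adjoint is v ↦ (y ↦ ⟪Z y, v⟫), and S*S is the
kernel operator of G. So the ξₙ = λₙ^{-1/2} S φₙ are left singular vectors of S, hence orthonormal,
and √λₙ φ̃ₙ(x) = ⟪ξₙ, Z x⟫. With U the closed span of the ξₙ, the Karhunen-Loève series is the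
projection of Z x onto U, the residual is the projection onto Uᗮ, and G₀ is its Gram kernel.

Gaussianity: the ξₙ and the residuals lie in the closed span of the Z x, all of whose elements are
Gaussian (`hasLaw_of_mem_gaussianSpace`); orthogonality then gives independence.

Vanishing: S is compact, so the spectral theorem for S*S puts its range in U
(`IsCompactOperator.map_mem_closure_span`). Hence S* v = 0 for v in Uᗮ, that is, ⟪Z y, v⟫ = 0 for
ν-almost every y. By continuity this holds on the support, where therefore Z x lies in U. -/

open scoped NNReal InnerProductSpace

/-! ### Projection onto the closed span of an orthonormal family -/

section Hilbert

variable {ι E : Type*} [NormedAddCommGroup E] [InnerProductSpace ℝ E] [CompleteSpace E]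

/-- Inside its own closed span the family has trivial orthogonal complement, so it is a Hilbert
basis there. -/
theorem Orthonormal.hasSum_starProjection {v : ι → E} (hv : Orthonormal ℝ v) (x : E) :
    HasSum (fun i => ⟪v i, x⟫_ℝ • v i)
      ((Submodule.span ℝ (range v)).topologicalClosure.starProjection x) := by
  set U := (Submodule.span ℝ (range v)).topologicalClosure
  have hvU (i : ι) : v i ∈ U :=
    Submodule.le_topologicalClosure _ (Submodule.subset_span (mem_range_self i))
  have hw : Orthonormal ℝ fun i => (⟨v i, hvU i⟩ : U) := hv.codRestrict U hvU
  have hbot : (Submodule.span ℝ (range fun i => (⟨v i, hvU i⟩ : U)))ᗮ = ⊥ := by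
    rw [Submodule.eq_bot_iff]
    intro u hu
    have hle : U ≤ (Submodule.span ℝ {(u : E)})ᗮ := by
      refine Submodule.topologicalClosure_minimal _ ?_ (Submodule.isClosed_orthogonal _)
      rw [Submodule.span_le]
      rintro _ ⟨i, rfl⟩
      rw [SetLike.mem_coe, Submodule.mem_orthogonal_singleton_iff_inner_left]
      exact (Submodule.mem_orthogonal _ _).1 hu _ (Submodule.subset_span ⟨i, rfl⟩)
    have := (Submodule.mem_orthogonal_singleton_iff_inner_left).1 (hle u.2)
    exact Subtype.ext (inner_self_eq_zero.1 this)
  have h := (HilbertBasis.mkOfOrthogonalEqBot hw hbot).hasSum_orthogonalProjectionOnto x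
  simp only [HilbertBasis.coe_mkOfOrthogonalEqBot] at h
  exact h.mapL U.subtypeL

theorem Orthonormal.hasSum_inner_mul_inner {v : ι → E} (hv : Orthonormal ℝ v) (x y : E) :
    HasSum (fun i => ⟪v i, x⟫_ℝ * ⟪v i, y⟫_ℝ)
      ⟪(Submodule.span ℝ (range v)).topologicalClosure.starProjection x, y⟫_ℝ := by
  have h := (hv.hasSum_starProjection x).mapL (innerSL ℝ y)
  simpa [inner_smul_right, real_inner_comm] using h

end Hilbert

/-! ### Gaussian Hilbert spaces -/

section GaussianHilbert

variable {Ω : Type*} [MeasurableSpace Ω] {P : Measure Ω}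

theorem MeasureTheory.Lp.integral_norm_le [IsProbabilityMeasure P] (f : Lp ℝ 2 P) :
    ∫ ω, ‖f ω‖ ∂P ≤ ‖f‖ := by
  have hf := Lp.memLp f
  rw [Lp.norm_def, integral_norm_eq_lintegral_enorm hf.1, ← eLpNorm_one_eq_lintegral_enorm]
  exact ENNReal.toReal_mono hf.2.ne
    (eLpNorm_le_eLpNorm_of_exponent_le (by norm_num) hf.1)

/-- Lipschitz with constant |t|, because |e^{ia} - e^{ib}| ≤ |a - b| and the L¹ norm is at most the
L² norm. -/
theorem continuous_charFun_map_Lp [IsProbabilityMeasure P] (t : ℝ) :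
    Continuous fun f : Lp ℝ 2 P => charFun (P.map f) t := by
  have hmeas (f : Lp ℝ 2 P) : AEMeasurable f P := (Lp.aestronglyMeasurable f).aemeasurable
  have hint (f : Lp ℝ 2 P) : Integrable (fun ω => Complex.exp (t * f ω * Complex.I)) P := by
    refine Integrable.of_bound (C := 1) ?_ (.of_forall fun ω => ?_)
    · have := hmeas f
      exact AEMeasurable.aestronglyMeasurable (by fun_prop)
    · rw [← Complex.ofReal_mul, Complex.norm_exp_ofReal_mul_I]
  have heq (f : Lp ℝ 2 P) :
      charFun (P.map f) t = ∫ ω, Complex.exp (t * f ω * Complex.I) ∂P := by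
    rw [charFun_apply_real, integral_map (hmeas f)]
    exact Measurable.aestronglyMeasurable (by fun_prop)
  refine (LipschitzWith.of_dist_le_mul (K := ‖t‖₊) fun f g => ?_).continuous
  rw [dist_eq_norm, dist_eq_norm, heq, heq, ← integral_sub (hint f) (hint g)]
  calc ‖∫ ω, (Complex.exp (t * f ω * Complex.I) - Complex.exp (t * g ω * Complex.I)) ∂P‖
      ≤ ∫ ω, ‖t‖ * ‖(f - g) ω‖ ∂P := by
        refine norm_integral_le_of_norm_le
          (((Lp.memLp (f - g)).integrable one_le_two).norm.const_mul _) ?_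
        filter_upwards [Lp.coeFn_sub f g] with ω hω
        have h : Complex.exp (t * f ω * Complex.I) - Complex.exp (t * g ω * Complex.I) =
            Complex.exp ((t * g ω : ℝ) * Complex.I) *
              (Complex.exp (Complex.I * (t * (f ω - g ω) : ℝ)) - 1) := by
          rw [mul_sub, ← Complex.exp_add, mul_one]
          push_cast
          ring_nf
        rw [h, norm_mul, Complex.norm_exp_ofReal_mul_I, one_mul, hω, Pi.sub_apply, ← norm_mul]
        exact Real.norm_exp_I_mul_ofReal_sub_one_le
    _ ≤ ‖t‖₊ * ‖f - g‖ := by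
        rw [integral_const_mul]
        exact mul_le_mul_of_nonneg_left (Lp.integral_norm_le _) (norm_nonneg _)

/-- Tying the variance to the norm turns Gaussianity into equations between characteristic
functions, one for each t, with both sides continuous in f. -/
theorem isClosed_setOf_hasLaw_gaussianReal [IsProbabilityMeasure P] :
    IsClosed {f : Lp ℝ 2 P | HasLaw (f : Ω → ℝ) (gaussianReal 0 (‖f‖₊ ^ 2)) P} := by
  have heq : {f : Lp ℝ 2 P | HasLaw (f : Ω → ℝ) (gaussianReal 0 (‖f‖₊ ^ 2)) P} =
      ⋂ t : ℝ, {f : Lp ℝ 2 P | charFun (P.map f) t = Complex.exp (-(‖f‖ ^ 2 * t ^ 2 / 2 : ℝ))} := by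
    ext f
    have hmeas : AEMeasurable f P := (Lp.aestronglyMeasurable f).aemeasurable
    have : IsProbabilityMeasure (P.map f) := Measure.isProbabilityMeasure_map hmeas
    have hiff : HasLaw (f : Ω → ℝ) (gaussianReal 0 (‖f‖₊ ^ 2)) P ↔
        P.map f = gaussianReal 0 (‖f‖₊ ^ 2) := ⟨fun h => h.map_eq, fun h => ⟨hmeas, h⟩⟩
    have hchar (t : ℝ) : charFun (gaussianReal 0 (‖f‖₊ ^ 2)) t =
        Complex.exp (-(‖f‖ ^ 2 * t ^ 2 / 2 : ℝ)) := by
      rw [charFun_gaussianReal]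
      simp
    simp only [mem_ofPred_eq, mem_iInter, hiff, ← hchar]
    exact ⟨fun h t => by rw [h], fun h => Measure.ext_of_charFun (funext h)⟩
  rw [heq]
  refine isClosed_iInter fun t => isClosed_eq (continuous_charFun_map_Lp t) ?_
  fun_prop

theorem ProbabilityTheory.covariance_congr_ae {X X' Y Y' : Ω → ℝ} (hX : X =ᵐ[P] X')
    (hY : Y =ᵐ[P] Y') : cov[X, Y; P] = cov[X', Y'; P] := by
  rw [covariance, covariance, integral_congr_ae hX, integral_congr_ae hY]
  refine integral_congr_ae ?_
  filter_upwards [hX, hY] with ω h h'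
  rw [h, h']

theorem inner_eq_covariance [IsProbabilityMeasure P] {f g : Lp ℝ 2 P}
    (hf : ∫ ω, f ω ∂P = 0) : ⟪f, g⟫_ℝ = cov[f, g; P] := by
  rw [covariance_eq_sub (Lp.memLp f) (Lp.memLp g), hf, zero_mul, sub_zero, L2.inner_def]
  simp [mul_comm]

variable {T : Type*} {Z : T → Ω → ℝ} {G : T → T → ℝ}

namespace IsCenteredGP

/-- The Gaussian Hilbert space generated by a centred Gaussian process. -/
noncomputable def gaussianSpace (hZ : IsCenteredGP Z G P) : Submodule ℝ (Lp ℝ 2 P) :=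
  (Submodule.span ℝ (range hZ.toL2)).topologicalClosure

variable (hZ : IsCenteredGP Z G P)

theorem coeFn_toL2 (x : T) : hZ.toL2 x =ᵐ[P] Z x := (hZ.memLp x).coeFn_toLp

theorem integral_toL2 (x : T) : ∫ ω, hZ.toL2 x ω ∂P = 0 := by
  rw [integral_congr_ae (hZ.coeFn_toL2 x), hZ.mean_zero]

variable [IsProbabilityMeasure P]

theorem inner_toL2 (x y : T) : ⟪hZ.toL2 x, hZ.toL2 y⟫_ℝ = G x y := by
  rw [inner_eq_covariance (hZ.integral_toL2 x), ← hZ.cov_eq]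
  exact covariance_congr_ae (hZ.coeFn_toL2 x) (hZ.coeFn_toL2 y)

theorem hasLaw_of_mem_gaussianSpace {f : Lp ℝ 2 P} (hf : f ∈ hZ.gaussianSpace) :
    HasLaw (f : Ω → ℝ) (gaussianReal 0 (‖f‖₊ ^ 2)) P := by
  suffices h : ((Submodule.span ℝ (range hZ.toL2) : Submodule ℝ (Lp ℝ 2 P)) : Set (Lp ℝ 2 P)) ⊆
      {f : Lp ℝ 2 P | HasLaw (f : Ω → ℝ) (gaussianReal 0 (‖f‖₊ ^ 2)) P} from
    closure_minimal h isClosed_setOf_hasLaw_gaussianReal hf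
  intro f hf
  obtain ⟨c, rfl⟩ := Finsupp.mem_span_range_iff_exists_finsupp.1 hf
  set f := c.sum fun i a => a • hZ.toL2 i
  have hfZ : f =ᵐ[P] fun ω => ∑ i ∈ c.support, c i • Z i ω := by
    refine (Lp.coeFn_fun_finsetSum c.support fun i => c i • hZ.toL2 i).trans ?_
    have h : ∀ i ∈ c.support, ∀ᵐ ω ∂P, (c i • hZ.toL2 i : Lp ℝ 2 P) ω = c i • Z i ω := by
      intro i _
      filter_upwards [Lp.coeFn_smul (c i) (hZ.toL2 i), hZ.coeFn_toL2 i] with ω h h'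
      rw [h, Pi.smul_apply, h']
    filter_upwards [(Filter.eventually_all_finset _).2 h] with ω hω
    exact Finset.sum_congr rfl hω
  have hlaw : HasGaussianLaw (f : Ω → ℝ) P :=
    ((hZ.gaussian.smul c).hasGaussianLaw_fun_sum).congr hfZ.symm
  have hmean : ∫ ω, f ω ∂P = 0 := by
    rw [integral_congr_ae hfZ, integral_finsetSum _ fun i _ =>
      Integrable.fun_smul (c i) ((hZ.memLp i).integrable one_le_two)]
    simp [integral_const_mul, hZ.mean_zero]
  refine ⟨hlaw.aemeasurable, ?_⟩
  rw [hlaw.map_eq_gaussianReal, hmean]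
  congr
  rw [← covariance_self hlaw.aemeasurable, ← inner_eq_covariance hmean,
    real_inner_self_eq_norm_sq]
  ext
  simp

theorem integral_of_mem_gaussianSpace {f : Lp ℝ 2 P} (hf : f ∈ hZ.gaussianSpace) :
    ∫ ω, f ω ∂P = 0 := by
  rw [(hZ.hasLaw_of_mem_gaussianSpace hf).integral_eq, integral_id_gaussianReal]

/-- Cramér-Wold: a linear functional of finitely many members is again a member, so its law is
Gaussian. -/
theorem isGaussianProcess_of_mem_gaussianSpace {S : Type*} {f : S → Lp ℝ 2 P}
    (hf : ∀ s, f s ∈ hZ.gaussianSpace) : IsGaussianProcess (fun s => (f s : Ω → ℝ)) P where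
  hasGaussianLaw I := by
    classical
    have hmeas (s : S) : AEMeasurable (f s) P := (Lp.aestronglyMeasurable (f s)).aemeasurable
    refine ⟨isGaussian_of_map_eq_gaussianReal fun L => ?_⟩
    set g : Lp ℝ 2 P := ∑ s : I, L (Pi.single s 1) • f s
    have hg : g ∈ hZ.gaussianSpace :=
      Submodule.sum_mem _ fun s _ => Submodule.smul_mem _ _ (hf s)
    refine ⟨0, ‖g‖₊ ^ 2, ?_⟩
    have hmeasI : AEMeasurable (fun ω => I.restrict fun s => f s ω) P :=
      aemeasurable_pi_lambda _ fun s => hmeas s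
    rw [← (hZ.hasLaw_of_mem_gaussianSpace hg).map_eq,
      AEMeasurable.map_map_of_aemeasurable (by fun_prop) hmeasI]
    refine Measure.map_congr ?_
    have h1 (s : I) := Lp.coeFn_smul (L (Pi.single s 1)) (f s)
    filter_upwards [Lp.coeFn_fun_finsetSum Finset.univ fun s : I => L (Pi.single s 1) • f s,
      ae_all_iff.2 h1] with ω hω h1
    rw [hω, Finset.sum_congr rfl fun s _ => h1 s, Function.comp_apply, ← L.sum_comp_single]
    refine Finset.sum_congr rfl fun s _ => ?_
    have h2 : Pi.single s (f s ω) = f s ω • (Pi.single s 1 : I → ℝ) := by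
      rw [← Pi.single_smul, smul_eq_mul, mul_one]
    simp [h2, mul_comm]

end IsCenteredGP

end GaussianHilbert

/-! ### Singular vectors of compact operators -/

section SingularSystem

variable {ι E F : Type*} [NormedAddCommGroup E] [InnerProductSpace ℝ E] [CompleteSpace E]
  [NormedAddCommGroup F] [InnerProductSpace ℝ F] [CompleteSpace F]
  {S : E →L[ℝ] F} {lam : ι → ℝ} {φ : ι → E}

theorem ContinuousLinearMap.inner_map_map_eq_of_adjoint_apply {μ : ℝ} {h : E}
    (hh : adjoint S (S h) = μ • h) (g : E) : ⟪S h, S g⟫_ℝ = μ * ⟪h, g⟫_ℝ := by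
  rw [← adjoint_inner_left, hh, real_inner_smul_left]

/-- The left singular vectors of an operator are orthonormal. -/
theorem orthonormal_inv_sqrt_smul_map (hpos : ∀ n, 0 < lam n) (hφ : Orthonormal ℝ φ)
    (heig : ∀ n, ContinuousLinearMap.adjoint S (S (φ n)) = lam n • φ n) :
    Orthonormal ℝ fun n => (1 / √(lam n)) • S (φ n) := by
  classical
  rw [orthonormal_iff_ite]
  intro n m
  rw [real_inner_smul_left, real_inner_smul_right,
    ContinuousLinearMap.inner_map_map_eq_of_adjoint_apply (heig n), orthonormal_iff_ite.1 hφ n m]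
  split_ifs with h
  · subst h
    have h1 := (Real.sqrt_pos.2 (hpos n)).ne'
    have h2 := Real.mul_self_sqrt (hpos n).le
    field_simp
    linarith
  · simp

/-- The range of a compact operator lies in the closed span of its left singular vectors. -/
theorem IsCompactOperator.map_mem_closure_span (hS : IsCompactOperator S) (hpos : ∀ n, 0 < lam n)
    (hexh : ∀ (μ : ℝ) (h : E), 0 < μ → ContinuousLinearMap.adjoint S (S h) = μ • h →
      h ∈ (Submodule.span ℝ (range φ)).topologicalClosure) (h : E) :
    S h ∈ (Submodule.span ℝ (range fun n => (1 / √(lam n)) • S (φ n))).topologicalClosure := by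
  set U := (Submodule.span ℝ (range fun n => (1 / √(lam n)) • S (φ n))).topologicalClosure
  set T : E →L[ℝ] E := ContinuousLinearMap.adjoint S ∘L S
  -- The claim is K = ⊤. As K is closed, it is enough that it contains every eigenspace of the
  -- compact self-adjoint operator T.
  set K : Submodule ℝ E := U.comap (S : E →ₗ[ℝ] F)
  have hKclosed : IsClosed (K : Set E) :=
    (Submodule.isClosed_topologicalClosure _).preimage S.continuous
  have hφK : (Submodule.span ℝ (range φ)).topologicalClosure ≤ K := by
    refine Submodule.topologicalClosure_minimal _ (Submodule.span_le.2 ?_) hKclosed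
    rintro _ ⟨n, rfl⟩
    have h1 : S (φ n) = √(lam n) • ((1 / √(lam n)) • S (φ n)) := by
      rw [smul_smul, mul_one_div_cancel (Real.sqrt_pos.2 (hpos n)).ne', one_smul]
    change S (φ n) ∈ U
    rw [h1]
    exact U.smul_mem _ (Submodule.le_topologicalClosure _ (Submodule.subset_span ⟨n, rfl⟩))
  have hT : IsCompactOperator T := hS.clm_comp (ContinuousLinearMap.adjoint S)
  have hTsymm : T.IsSymmetric := by
    intro x y
    change ⟪ContinuousLinearMap.adjoint S (S x), y⟫_ℝ = ⟪x, ContinuousLinearMap.adjoint S (S y)⟫_ℝ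
    rw [ContinuousLinearMap.adjoint_inner_left, ContinuousLinearMap.adjoint_inner_right]
  have hle : (⨆ μ, Module.End.eigenspace (T : Module.End ℝ E) μ) ≤ K := by
    refine iSup_le fun μ g hg => ?_
    have hg' : ContinuousLinearMap.adjoint S (S g) = μ • g := Module.End.mem_eigenspace_iff.1 hg
    rcases lt_or_ge 0 μ with hμ | hμ
    · exact hφK (hexh μ g hμ hg')
    -- Here ‖S g‖² = μ ‖g‖² ≤ 0, so S kills the eigenvectors that the family φ need not reach.
    · have h0 := ContinuousLinearMap.inner_map_map_eq_of_adjoint_apply hg' g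
      have h1 : ⟪S g, S g⟫_ℝ ≤ 0 :=
        h0.trans_le (mul_nonpos_of_nonpos_of_nonneg hμ real_inner_self_nonneg)
      have h2 : S g = 0 := inner_self_eq_zero.1 (h1.antisymm real_inner_self_nonneg)
      change S g ∈ U
      rw [h2]
      exact U.zero_mem
  have hbot : Kᗮ = ⊥ := by
    rw [← le_bot_iff,
      ← ContinuousLinearMap.orthogonalComplement_iSup_eigenspaces_eq_bot hT hTsymm]
    exact Submodule.orthogonal_le hle
  have : CompleteSpace K := hKclosed.completeSpace_coe
  have htop : K = ⊤ := Submodule.orthogonal_eq_bot_iff.1 hbot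
  have : h ∈ K := htop ▸ Submodule.mem_top
  exact this

end SingularSystem

/-! ### The integral operator of a square integrable vector-valued function -/

section BochnerOperator

variable {α H : Type*} [MeasurableSpace α] {ν : Measure α}
  [NormedAddCommGroup H] [InnerProductSpace ℝ H] [CompleteSpace H]

/-- The operator `h ↦ ∫ h z dν` from `L²(ν)` to `H` of a square integrable function `z`. -/
noncomputable def weightedIntegralCLM (z : Lp H 2 ν) : Lp ℝ 2 ν →L[ℝ] H :=
  (ContinuousLinearMap.lsmul ℝ ℝ (E := H)).flip.lpPairing ν 2 2 z

theorem weightedIntegralCLM_toLp {z : α → H} (hz : MemLp z 2 ν) (h : Lp ℝ 2 ν) :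
    weightedIntegralCLM hz.toLp h = ∫ y, h y • z y ∂ν := by
  rw [weightedIntegralCLM, ContinuousLinearMap.lpPairing_eq_integral]
  refine integral_congr_ae ?_
  filter_upwards [hz.coeFn_toLp] with y hy
  simp [hy]

/-- The operator has rank at most one when z is a constant vector on a set; sums and norm limits of
compact operators are compact. -/
theorem isCompactOperator_weightedIntegralCLM (z : Lp H 2 ν) :
    IsCompactOperator (weightedIntegralCLM z) := by
  induction z using Lp.induction (p := 2) ENNReal.ofNat_ne_top with
  | indicatorConst c hs hμs =>
    rename_i s
    set l : Lp ℝ 2 ν →L[ℝ] ℝ := weightedIntegralCLM (indicatorConstLp 2 hs hμs.ne (1 : ℝ))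
    have h : weightedIntegralCLM (Lp.simpleFunc.indicatorConst 2 hs hμs.ne c : Lp H 2 ν) =
        ContinuousLinearMap.toSpanSingleton ℝ c ∘L l := by
      ext h
      simp only [l, weightedIntegralCLM, ContinuousLinearMap.comp_apply,
        ContinuousLinearMap.toSpanSingleton_apply, ContinuousLinearMap.lpPairing_eq_integral,
        Lp.simpleFunc.coe_indicatorConst]
      rw [← integral_smul_const]
      refine integral_congr_ae ?_
      filter_upwards [indicatorConstLp_coeFn (p := 2) (hs := hs) (hμs := hμs.ne) (c := c),
        indicatorConstLp_coeFn (p := 2) (hs := hs) (hμs := hμs.ne) (c := (1 : ℝ))] with y h1 h2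
      rw [h1, h2]
      by_cases hy : y ∈ s <;> simp [hy]
    rw [h]
    have hl : IsCompactOperator l := isCompactOperator_of_locallyCompactSpace_dom l
    exact hl.clm_comp (ContinuousLinearMap.toSpanSingleton ℝ c)
  | add hf hg _ hf' hg' =>
    simp only [weightedIntegralCLM, map_add] at hf' hg' ⊢
    exact hf'.add hg'
  | isClosed =>
    exact isClosed_setOfPred_isCompactOperator.preimage
      (ContinuousLinearMap.continuous ((ContinuousLinearMap.lsmul ℝ ℝ (E := H)).flip.lpPairing ν 2 2))

theorem adjoint_weightedIntegralCLM_toLp {z : α → H} (hz : MemLp z 2 ν) (v : H) :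
    ContinuousLinearMap.adjoint (weightedIntegralCLM hz.toLp) v =ᵐ[ν] fun y => ⟪z y, v⟫_ℝ := by
  have hk : MemLp (fun y => ⟪z y, v⟫_ℝ) 2 ν := hz.inner_const v
  suffices h : ContinuousLinearMap.adjoint (weightedIntegralCLM hz.toLp) v = hk.toLp by
    rw [h]; exact hk.coeFn_toLp
  refine ext_inner_right ℝ fun g => ?_
  have hint : Integrable (fun y => g y • z y) ν :=
    memLp_one_iff_integrable.1 (MemLp.smul (p := 2) (q := 2) hz (Lp.memLp g))
  rw [ContinuousLinearMap.adjoint_inner_left, weightedIntegralCLM_toLp, ← integral_inner hint,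
    L2.inner_def]
  refine integral_congr_ae ?_
  filter_upwards [hk.coeFn_toLp] with y hy
  rw [hy, real_inner_smul_right, real_inner_comm v]
  simp

end BochnerOperator

/-! ### Mean-square continuity -/

section Continuity

variable {Ω T : Type*} [MeasurableSpace Ω] {P : Measure Ω} [IsProbabilityMeasure P]
  [TopologicalSpace T] {Z : T → Ω → ℝ} {G : T → T → ℝ}

namespace IsCenteredGP

theorem continuous_toL2 (hZ : IsCenteredGP Z G P) (hG : Continuous fun p : T × T => G p.1 p.2) :
    Continuous hZ.toL2 := by
  refine continuous_iff_continuousAt.2 fun x => tendsto_iff_norm_sub_tendsto_zero.2 ?_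
  have hnorm (y : T) : ‖hZ.toL2 y - hZ.toL2 x‖ = √(G y y - 2 * G y x + G x x) := by
    rw [← Real.sqrt_sq (norm_nonneg (hZ.toL2 y - hZ.toL2 x)), norm_sub_sq_real,
      ← real_inner_self_eq_norm_sq, ← real_inner_self_eq_norm_sq, hZ.inner_toL2, hZ.inner_toL2,
      hZ.inner_toL2]
  have hcont : Continuous fun y => √(G y y - 2 * G y x + G x x) := by
    have h1 : Continuous fun y => G y y := hG.comp (continuous_id.prodMk continuous_id)
    have h2 : Continuous fun y => G y x := hG.comp (continuous_id.prodMk continuous_const)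
    fun_prop
  have h := hcont.tendsto x
  simp only [hnorm]
  convert h using 2
  rw [show G x x - 2 * G x x + G x x = 0 by ring, Real.sqrt_zero]

variable [MeasurableSpace T] [OpensMeasurableSpace T] [SecondCountableTopology T]

theorem memLp_toL2 (hZ : IsCenteredGP Z G P) (hG : Continuous fun p : T × T => G p.1 p.2)
    {C : Set T} (hC : IsCompact C) (ν : Measure C) [IsFiniteMeasure ν] :
    MemLp (fun y : C => hZ.toL2 (y : T)) 2 ν := by
  have hcont : Continuous fun y : C => hZ.toL2 (y : T) :=
    (hZ.continuous_toL2 hG).comp continuous_subtype_val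
  obtain ⟨b, hb⟩ := hC.exists_bound_of_continuousOn (hZ.continuous_toL2 hG).continuousOn
  exact MemLp.of_bound hcont.aestronglyMeasurable b (.of_forall fun y => hb y y.2)

end IsCenteredGP

end Continuity

/-! ### The Karhunen-Loève expansion and its residual -/

section KarhunenLoeve

variable {Ω T ι : Type*} [MeasurableSpace Ω] {P : Measure Ω} [MeasurableSpace T]
  {Z : T → Ω → ℝ} {G : T → T → ℝ}

namespace IsCenteredGP

variable {C : Set T} {ν : Measure C} {lam : ι → ℝ} {φ : ι → Lp ℝ 2 ν}
  (hZ : IsCenteredGP Z G P) (hz : MemLp (fun y : C => hZ.toL2 (y : T)) 2 ν)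

include hz in
theorem integrable_smul_toL2 (h : Lp ℝ 2 ν) : Integrable (fun y : C => h y • hZ.toL2 (y : T)) ν :=
  memLp_one_iff_integrable.1 (MemLp.smul (p := 2) (q := 2) hz (Lp.memLp h))

theorem klCoeff_eq (n : ι) :
    klCoeff hZ ν lam φ n = (1 / √(lam n)) • weightedIntegralCLM hz.toLp (φ n) := by
  rw [klCoeff, weightedIntegralCLM_toLp]

variable [IsProbabilityMeasure P]

theorem inner_toL2_weightedIntegralCLM (h : Lp ℝ 2 ν) (x : T) :
    ⟪hZ.toL2 x, weightedIntegralCLM hz.toLp h⟫_ℝ = kernelIntegral G ν h x := by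
  rw [weightedIntegralCLM_toLp, ← integral_inner (hZ.integrable_smul_toL2 hz h), kernelIntegral]
  simp only [real_inner_smul_right, hZ.inner_toL2, mul_comm]

theorem eigenEq_iff (μ : ℝ) (h : Lp ℝ 2 ν) : EigenEq G ν μ h ↔
    ContinuousLinearMap.adjoint (weightedIntegralCLM hz.toLp) (weightedIntegralCLM hz.toLp h) =
      μ • h := by
  have h1 := adjoint_weightedIntegralCLM_toLp hz (weightedIntegralCLM hz.toLp h)
  simp only [hZ.inner_toL2_weightedIntegralCLM hz] at h1
  rw [Lp.ext_iff]
  refine ⟨fun heq => ?_, fun heq => ?_⟩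
  · filter_upwards [h1, heq, Lp.coeFn_smul μ h] with y h1 h2 h3
    rw [h1, h2, h3, Pi.smul_apply, smul_eq_mul]
  · filter_upwards [h1, heq, Lp.coeFn_smul μ h] with y h1 h2 h3
    rw [← h1, h2, h3, Pi.smul_apply, smul_eq_mul]

include hz

-- The projection onto the Gaussian space commutes with the Bochner integral and fixes its
-- integrand.
omit [IsProbabilityMeasure P] in
theorem klCoeff_mem_gaussianSpace (n : ι) : klCoeff hZ ν lam φ n ∈ hZ.gaussianSpace := by
  refine hZ.gaussianSpace.smul_mem _ ?_
  have : CompleteSpace hZ.gaussianSpace :=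
    (Submodule.isClosed_topologicalClosure _).completeSpace_coe
  rw [← Submodule.starProjection_eq_self_iff,
    ← ContinuousLinearMap.integral_comp_comm _ (hZ.integrable_smul_toL2 hz (φ n))]
  refine integral_congr_ae (.of_forall fun y => ?_)
  exact Submodule.starProjection_eq_self_iff.2 (hZ.gaussianSpace.smul_mem _
    (Submodule.le_topologicalClosure _ (Submodule.subset_span ⟨_, rfl⟩)))

theorem orthonormal_klCoeff (hKL : IsEigenSystem G ν lam φ) :
    Orthonormal ℝ (klCoeff hZ ν lam φ) := by
  have h := orthonormal_inv_sqrt_smul_map hKL.pos hKL.orthonormal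
    fun n => (hZ.eigenEq_iff hz _ _).1 (hKL.eigen n)
  rwa [← funext fun n => hZ.klCoeff_eq hz (lam := lam) (φ := φ) n] at h

theorem inner_klCoeff_toL2 (hpos : ∀ n, 0 < lam n) (n : ι) (x : T) :
    ⟪klCoeff hZ ν lam φ n, hZ.toL2 x⟫_ℝ = √(lam n) * lifted G ν lam φ n x := by
  rw [hZ.klCoeff_eq hz, real_inner_smul_left, real_inner_comm,
    hZ.inner_toL2_weightedIntegralCLM hz, lifted]
  have h1 := (Real.sqrt_pos.2 (hpos n)).ne'
  have h2 := Real.sq_sqrt (hpos n).le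
  have h3 := (hpos n).ne'
  field_simp
  rw [h2, mul_comm]

theorem klTerm_eq (hpos : ∀ n, 0 < lam n) (x : T) (n : ι) : klTerm hZ ν lam φ x n =
    ⟪klCoeff hZ ν lam φ n, hZ.toL2 x⟫_ℝ • klCoeff hZ ν lam φ n := by
  rw [klTerm, hZ.inner_klCoeff_toL2 hz hpos]

theorem mul_lifted_mul_lifted (hpos : ∀ n, 0 < lam n) (x x' : T) (n : ι) :
    lam n * lifted G ν lam φ n x * lifted G ν lam φ n x' =
      ⟪klCoeff hZ ν lam φ n, hZ.toL2 x⟫_ℝ * ⟪klCoeff hZ ν lam φ n, hZ.toL2 x'⟫_ℝ := by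
  rw [hZ.inner_klCoeff_toL2 hz hpos, hZ.inner_klCoeff_toL2 hz hpos, mul_mul_mul_comm,
    Real.mul_self_sqrt (hpos n).le, mul_assoc]

theorem hasSum_klTerm (hKL : IsEigenSystem G ν lam φ) (x : T) :
    HasSum (klTerm hZ ν lam φ x)
      ((Submodule.span ℝ (range (klCoeff hZ ν lam φ))).topologicalClosure.starProjection
        (hZ.toL2 x)) := by
  have h := (hZ.orthonormal_klCoeff hz hKL).hasSum_starProjection (hZ.toL2 x)
  rwa [← funext fun n => hZ.klTerm_eq hz hKL.pos x n] at h

theorem hasSum_mul_lifted_mul_lifted (hKL : IsEigenSystem G ν lam φ) (x x' : T) :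
    HasSum (fun n => lam n * lifted G ν lam φ n x * lifted G ν lam φ n x')
      ⟪(Submodule.span ℝ (range (klCoeff hZ ν lam φ))).topologicalClosure.starProjection
        (hZ.toL2 x), hZ.toL2 x'⟫_ℝ := by
  simp only [hZ.mul_lifted_mul_lifted hz hKL.pos]
  exact (hZ.orthonormal_klCoeff hz hKL).hasSum_inner_mul_inner _ _

theorem hasLaw_klCoeff (hKL : IsEigenSystem G ν lam φ) (n : ι) :
    HasLaw (klCoeff hZ ν lam φ n : Ω → ℝ) (gaussianReal 0 1) P := by
  have h := hZ.hasLaw_of_mem_gaussianSpace (hZ.klCoeff_mem_gaussianSpace hz (lam := lam) (φ := φ) n)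
  have h1 : ‖klCoeff hZ ν lam φ n‖₊ = 1 :=
    NNReal.eq ((hZ.orthonormal_klCoeff hz hKL).norm_eq_one n)
  rwa [h1, one_pow] at h

theorem iIndepFun_klCoeff (hKL : IsEigenSystem G ν lam φ) :
    iIndepFun (fun n => (klCoeff hZ ν lam φ n : Ω → ℝ)) P := by
  have hmem := hZ.klCoeff_mem_gaussianSpace hz (lam := lam) (φ := φ)
  -- The criterion concerns families of processes, so each coefficient is viewed as a process
  -- indexed by `Unit`.
  have h := IsGaussianProcess.iIndepFun_of_covariance_eq_zero (S := fun _ : ι => Unit)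
    (X := fun n _ => (klCoeff hZ ν lam φ n : Ω → ℝ))
    (hZ.isGaussianProcess_of_mem_gaussianSpace (f := fun p : (_ : ι) × Unit => _)
      fun p => hmem p.1)
    (fun n _ => (Lp.aestronglyMeasurable _).aemeasurable)
    fun n m hnm _ _ => by
      rw [← inner_eq_covariance (hZ.integral_of_mem_gaussianSpace (hmem n))]
      exact (hZ.orthonormal_klCoeff hz hKL).inner_eq_zero hnm
  exact h.comp (fun _ f => f ()) fun _ => measurable_pi_apply _

omit hz [IsProbabilityMeasure P] in
/-- The residual of the Karhunen-Loève expansion at `x`, as an element of `L²(P)`: the projection of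
`Z x` onto the orthogonal complement of the Karhunen-Loève coefficients. -/
noncomputable def klResidual (ν : Measure C) (lam : ι → ℝ) (φ : ι → Lp ℝ 2 ν) (x : T) : Lp ℝ 2 P :=
  (Submodule.span ℝ (range (klCoeff hZ ν lam φ))).topologicalClosureᗮ.starProjection (hZ.toL2 x)

omit hz [IsProbabilityMeasure P] in
theorem klResidual_eq_sub (x : T) : hZ.klResidual ν lam φ x = hZ.toL2 x -
    (Submodule.span ℝ (range (klCoeff hZ ν lam φ))).topologicalClosure.starProjection
      (hZ.toL2 x) := by
  rw [klResidual, Submodule.starProjection_orthogonal_val]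

omit [IsProbabilityMeasure P] in
theorem klResidual_mem_gaussianSpace (x : T) : hZ.klResidual ν lam φ x ∈ hZ.gaussianSpace := by
  rw [klResidual_eq_sub]
  refine hZ.gaussianSpace.sub_mem
    (Submodule.le_topologicalClosure _ (Submodule.subset_span ⟨x, rfl⟩)) ?_
  have hle : (Submodule.span ℝ (range (klCoeff hZ ν lam φ))).topologicalClosure ≤
      hZ.gaussianSpace := by
    refine Submodule.topologicalClosure_minimal _ (Submodule.span_le.2 ?_)
      (Submodule.isClosed_topologicalClosure _)
    rintro _ ⟨n, rfl⟩
    exact hZ.klCoeff_mem_gaussianSpace hz n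
  exact hle (Submodule.starProjection_apply_mem _ _)

theorem inner_klResidual_toL2 (hKL : IsEigenSystem G ν lam φ) (x x' : T) :
    ⟪hZ.klResidual ν lam φ x, hZ.toL2 x'⟫_ℝ = residualKernel G ν lam φ x x' := by
  rw [klResidual_eq_sub, inner_sub_left, hZ.inner_toL2, residualKernel,
    (hZ.hasSum_mul_lifted_mul_lifted hz hKL x x').tsum_eq]

/-- A projection is self-adjoint and idempotent, so projecting both arguments is the same as
projecting one. -/
theorem inner_klResidual_klResidual (hKL : IsEigenSystem G ν lam φ) (x x' : T) :
    ⟪hZ.klResidual ν lam φ x, hZ.klResidual ν lam φ x'⟫_ℝ = residualKernel G ν lam φ x x' := by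
  rw [← hZ.inner_klResidual_toL2 hz hKL]
  have h : (Submodule.span ℝ (range (klCoeff hZ ν lam φ))).topologicalClosureᗮ.starProjection
      (hZ.klResidual ν lam φ x) = hZ.klResidual ν lam φ x :=
    Submodule.starProjection_eq_self_iff.2 (Submodule.starProjection_apply_mem _ _)
  conv_lhs => rw [klResidual, klResidual, ← Submodule.inner_starProjection_left_eq_right]
  exact congrArg (⟪·, hZ.toL2 x'⟫_ℝ) h

theorem ae_eq_klResidual (hKL : IsEigenSystem G ν lam φ) {Z₀ : T → Ω → ℝ}
    (hZ₀ : IsKLResidual hZ ν lam φ Z₀) (x : T) : hZ.klResidual ν lam φ x =ᵐ[P] Z₀ x := by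
  rw [klResidual_eq_sub, ← (hZ.hasSum_klTerm hz hKL x).tsum_eq]
  filter_upwards [hZ₀ x, hZ.coeFn_toL2 x,
    Lp.coeFn_sub (hZ.toL2 x) (∑' n, klTerm hZ ν lam φ x n)] with ω h1 h2 h3
  rw [h1, h3, Pi.sub_apply, h2]

theorem isCenteredGP_of_isKLResidual (hKL : IsEigenSystem G ν lam φ) {Z₀ : T → Ω → ℝ}
    (hZ₀ : IsKLResidual hZ ν lam φ Z₀) : IsCenteredGP Z₀ (residualKernel G ν lam φ) P := by
  have hmem := hZ.klResidual_mem_gaussianSpace hz (lam := lam) (φ := φ)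
  have hae := hZ.ae_eq_klResidual hz hKL hZ₀
  refine ⟨(hZ.isGaussianProcess_of_mem_gaussianSpace hmem).congr hae, fun x => ?_, fun x x' => ?_⟩
  · rw [← integral_congr_ae (hae x)]
    exact hZ.integral_of_mem_gaussianSpace (hmem x)
  · rw [← covariance_congr_ae (hae x) (hae x'),
      ← inner_eq_covariance (hZ.integral_of_mem_gaussianSpace (hmem x)),
      hZ.inner_klResidual_klResidual hz hKL]

/-- The residual is zero in the directions of the process restricted to the support. -/
theorem klResidual_eq_zero (hKL : IsEigenSystem G ν lam φ) [TopologicalSpace T]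
    (hcont : Continuous hZ.toL2) {x : C} (hx : x ∈ ν.support) :
    hZ.klResidual ν lam φ x = 0 := by
  set U := (Submodule.span ℝ (range (klCoeff hZ ν lam φ))).topologicalClosure
  refine ext_inner_right ℝ fun v => ?_
  rw [inner_zero_left]
  have hcont' : Continuous fun y : C => ⟪hZ.toL2 (y : T), Uᗮ.starProjection v⟫_ℝ :=
    (hcont.comp continuous_subtype_val).inner continuous_const
  have hS (h : Lp ℝ 2 ν) : weightedIntegralCLM hz.toLp h ∈ U := by
    have h1 := (isCompactOperator_weightedIntegralCLM hz.toLp).map_mem_closure_span hKL.pos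
      (fun μ h hμ hh => hKL.exhaustive μ h hμ ((hZ.eigenEq_iff hz μ h).2 hh)) h
    rwa [← funext fun n => hZ.klCoeff_eq hz (lam := lam) (φ := φ) n] at h1
  have hadj : ContinuousLinearMap.adjoint (weightedIntegralCLM hz.toLp) (Uᗮ.starProjection v) =
      0 := by
    refine ext_inner_right ℝ fun h => ?_
    rw [ContinuousLinearMap.adjoint_inner_left, inner_zero_left]
    exact Submodule.inner_left_of_mem_orthogonal (hS h) (Submodule.starProjection_apply_mem _ _)
  have hae : ∀ᵐ y : C ∂ν, ⟪hZ.toL2 (y : T), Uᗮ.starProjection v⟫_ℝ = 0 := by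
    have h1 := adjoint_weightedIntegralCLM_toLp hz (Uᗮ.starProjection v)
    rw [hadj] at h1
    filter_upwards [h1, Lp.coeFn_zero ℝ 2 ν] with y h1 h2
    rw [← h1, h2, Pi.zero_apply]
  -- By continuity this set is closed; having full measure, it contains the support.
  have hmem : x ∈ {y : C | ⟪hZ.toL2 (y : T), Uᗮ.starProjection v⟫_ℝ = 0} :=
    Measure.support_subset_of_isClosed (isClosed_eq hcont' continuous_const) hae hx
  rw [klResidual, Submodule.inner_starProjection_left_eq_right]
  exact hmem

end IsCenteredGP

end KarhunenLoeve

theorem proposition1 {d : ℕ} {D : Set (EuclideanSpace ℝ (Fin d))} (hD : IsCompact D)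
    {Ω : Type*} [MeasurableSpace Ω] {P : Measure Ω} [IsProbabilityMeasure P]
    {Z : D → Ω → ℝ} {G : D → D → ℝ}
    (hG : Continuous fun p : D × D => G p.1 p.2) (hZ : IsCenteredGP Z G P)
    {C : Set D} (hC : IsCompact C) (ν : Measure C) [IsProbabilityMeasure ν]
    {ι : Type*} {lam : ι → ℝ} {φ : ι → Lp ℝ 2 ν} (hKL : IsEigenSystem G ν lam φ) :
    -- the Karhunen-Loève coefficients are i.i.d. standard normal
    (iIndepFun (fun n => (klCoeff hZ ν lam φ n : Ω → ℝ)) P ∧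
      ∀ n, HasLaw (klCoeff hZ ν lam φ n : Ω → ℝ) (gaussianReal 0 1) P) ∧
    -- the series defining `Z₀` and `G₀` converge
    (∀ x, Summable (klTerm hZ ν lam φ x)) ∧
    (∀ x x', Summable fun n => lam n * lifted G ν lam φ n x * lifted G ν lam φ n x') ∧
    -- `Z₀` is a centred Gaussian process with kernel `G₀`
    (∀ Z₀ : D → Ω → ℝ, IsKLResidual hZ ν lam φ Z₀ →
      IsCenteredGP Z₀ (residualKernel G ν lam φ) P) ∧
    -- `Z₀` and `G₀` vanish on the support of `ν`
    (∀ Z₀ : D → Ω → ℝ, IsKLResidual hZ ν lam φ Z₀ → ∀ x : C, x ∈ ν.support → Z₀ x =ᵐ[P] 0) ∧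
    (∀ x : C, x ∈ ν.support → ∀ x' : D, residualKernel G ν lam φ x x' = 0) ∧
    -- in particular, `Z₀` and `G₀` vanish on all of `C` if the support of `ν` is `C`
    (ν.support = univ →
      (∀ Z₀ : D → Ω → ℝ, IsKLResidual hZ ν lam φ Z₀ → ∀ x : C, Z₀ x =ᵐ[P] 0) ∧
      ∀ (x : C) (x' : D), residualKernel G ν lam φ x x' = 0) := by
  have hcont := hZ.continuous_toL2 hG
  have hz := hZ.memLp_toL2 hG hC ν
  have hZ₀_zero (Z₀ : D → Ω → ℝ) (hZ₀ : IsKLResidual hZ ν lam φ Z₀) (x : C)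
      (hx : x ∈ ν.support) : Z₀ x =ᵐ[P] 0 := by
    have h := hZ.ae_eq_klResidual hz hKL hZ₀ x
    rw [hZ.klResidual_eq_zero hz hKL hcont hx] at h
    exact h.symm.trans (Lp.coeFn_zero ℝ 2 P)
  have hG₀_zero (x : C) (hx : x ∈ ν.support) (x' : D) : residualKernel G ν lam φ x x' = 0 := by
    rw [← hZ.inner_klResidual_toL2 hz hKL, hZ.klResidual_eq_zero hz hKL hcont hx, inner_zero_left]
  exact ⟨⟨hZ.iIndepFun_klCoeff hz hKL, hZ.hasLaw_klCoeff hz hKL⟩,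
    fun x => (hZ.hasSum_klTerm hz hKL x).summable,
    fun x x' => (hZ.hasSum_mul_lifted_mul_lifted hz hKL x x').summable,
    fun Z₀ hZ₀ => hZ.isCenteredGP_of_isKLResidual hz hKL hZ₀,
    hZ₀_zero, hG₀_zero, fun hsupp =>
      ⟨fun Z₀ hZ₀ x => hZ₀_zero Z₀ hZ₀ x (hsupp ▸ mem_univ x),
        fun x => hG₀_zero x (hsupp ▸ mem_univ x)⟩⟩
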